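/- Let $k\ge 2$. Let $q_1,q_2,q_3\in\mathbb R^2$ be the vertices of an equilateral triangle $T$, let $V_0=\{q_1,q_2,q_3\}$, and let $F_i(x)=x/k+b_i$, $1\le i\le k(k+1)/2$, be the contractions that map $T$ onto the $k(k+1)/2$ upward-pointing subtriangles obtained by dividing the sides of $T$ into $k$ equal parts. Let $SG_k$ be the level-$k$ Sierpiński gasket, i.e. the unique non-empty compact set with $SG_k=\bigcup_i F_i(SG_k)$; the sets $F_i(SG_k)$ are its cells. For $m\ge 0$ let $G_m$ be the graph whose vertex set $V_m$ is the union of the sets $F_w(V_0)=F_{w_1}\circ\cdots\circ F_{w_m}(V_0)$ over all words $w$ of length $m$, two distinct vertices being adjacent ($x\sim_m y$) when they lie in a common $F_w(V_0)$. A function $h:V_m\to\mathbb R$ is harmonic on $G_m$ if $\sum_{y\sim_m x}(h(y)-h(x))=0$ for every $x\in V_m\setminus V_0$; a continuous function on $SG_k$ is harmonic if its restriction to $V_m$ is harmonic on $G_m$ for every $m$. For each $i$ the harmonic extension matrix $A_i$ is the $3\times 3$ matrix such that $$\bigl(h(F_iq_1),h(F_iq_2),h(F_iq_3)\bigr)^{T}=A_i\,\bigl(h(q_1),h(q_2),h(q_3)\bigr)^{T}$$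 for every function $h$ that is harmonic on $G_1$. Theorem. For every $k\ge 2$ the harmonic structure on $SG_k$ is non-degenerate, that is, $A_i$ is invertible for every $1\le i\le k(k+1)/2$. Consequently, for each $i$, a harmonic function on $G_1$ that takes the same value at $F_iq_1,F_iq_2,F_iq_3$ is constant, and a harmonic function on $SG_k$ that is constant on the cell $F_i(SG_k)$ is constant. -/

import Mathlib

namespace SierpinskiGasket

/-- The Euclidean plane. -/
abbrev Plane : Type := EuclideanSpace ℝ (Fin 2)

/-- The vertices of the initial (equilateral) triangle, that is, the boundary points. -/
noncomputable def q : Fin 3 → Plane :=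
  ![!₂[1 / 2, Real.sqrt 3 / 2], !₂[0, 0], !₂[1, 0]]

/-- The boundary `V₀`, consisting of the three vertices of the outermost triangle. -/
def boundary : Set Plane := Set.range q

/-- The index set of the `k (k + 1) / 2` upward triangles obtained by dividing the sides of the
initial triangle into `k` equal parts: triples of natural numbers with sum `k - 1`. -/
def Index (k : ℕ) : Type := {a : Fin 3 → ℕ // a 0 + a 1 + a 2 + 1 = k}

/-- The contraction `F_a x = x / k + b_a`, where `b_a = (∑ j, a j • q j) / k`; it maps the initial
triangle onto the upward subtriangle with index `a`. -/
noncomputable def F (k : ℕ) (a : Index k) (x : Plane) : Plane :=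
  (k : ℝ)⁻¹ • x + (k : ℝ)⁻¹ • ∑ j, (a.1 j : ℝ) • q j

/-- The composition `F_w = F_{w₁} ∘ ⋯ ∘ F_{wₘ}` along a word `w`. -/
noncomputable def wordMap (k : ℕ) (w : List (Index k)) (x : Plane) : Plane :=
  w.foldr (F k) x

/-- The vertex set `V_m` of the `m`-th graph approximation: the union of the sets `F_w V₀` over all
words `w` of length `m`. -/
def V (k m : ℕ) : Set Plane :=
  {x | ∃ w : List (Index k), w.length = m ∧ ∃ j, wordMap k w (q j) = x}

/-- The level-`k` Sierpinski gasket, as the closure of the union of the sets `V_m`. By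
`isAttractor_gasket` and `eq_gasket_of_isAttractor` below, for `k ≥ 2` it is the unique non-empty
compact set `K` with `K = ⋃ a, F_a K`. -/
def gasket (k : ℕ) : Set Plane := closure (⋃ m, V k m)

/-- `K` is a non-empty compact set with `K = ⋃ a, F_a K`. -/
def IsAttractor (k : ℕ) (K : Set Plane) : Prop :=
  K.Nonempty ∧ IsCompact K ∧ K = ⋃ a : Index k, F k a '' K

/-- The graph approximation `G_m`: two distinct points of `V_m` are adjacent when they are vertices
of a common cell `F_w V₀` with `w` of length `m`. -/
def G (k m : ℕ) : SimpleGraph (V k m) where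
  Adj x y := x ≠ y ∧ ∃ w : List (Index k), w.length = m ∧
    (∃ i, wordMap k w (q i) = x.1) ∧ ∃ j, wordMap k w (q j) = y.1
  symm := ⟨fun _ _ ⟨hne, w, hw, hx, hy⟩ => ⟨hne.symm, w, hw, hy, hx⟩⟩
  loopless := ⟨fun _ h => h.1 rfl⟩

instance finite_index (k : ℕ) : Finite (Index k) := by
  have : Set.Finite {a : Fin 3 → ℕ | a 0 + a 1 + a 2 + 1 = k} := by
    refine (Set.finite_Iic (fun _ : Fin 3 => k)).subset ?_
    intro a ha j
    simp only [Set.mem_ofPred_eq] at ha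
    fin_cases j <;> simp <;> omega
  exact this.to_subtype

theorem finite_V (k m : ℕ) : (V k m).Finite := by
  have h : V k m = ⋃ j, (fun w => wordMap k w (q j)) '' {w : List (Index k) | w.length = m} := by
    ext x
    simp only [V, Set.mem_ofPred_eq, Set.mem_iUnion, Set.mem_image]
    exact ⟨fun ⟨w, hw, j, hj⟩ => ⟨j, w, hw, hj⟩, fun ⟨j, w, hw, hj⟩ => ⟨w, hw, j, hj⟩⟩
  rw [h]
  exact Set.finite_iUnion fun j => (List.finite_length_eq (Index k) m).image _

noncomputable instance fintypeV (k m : ℕ) : Fintype (V k m) := (finite_V k m).fintype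

open Classical in
/-- The graph Laplacian `Δ_m` of `G_m`, all edges having conductance one. -/
noncomputable def laplacian (k m : ℕ) (h : V k m → ℝ) (x : V k m) : ℝ :=
  ∑ y ∈ (G k m).neighborFinset x, (h y - h x)

/-- `h` is harmonic on `G_m`: `Δ_m h = 0` off the boundary `V₀`. -/
def IsGraphHarmonic (k m : ℕ) (h : V k m → ℝ) : Prop :=
  ∀ x : V k m, x.1 ∉ boundary → laplacian k m h x = 0

/-- `h` is a harmonic function on the gasket: it is continuous there and its restriction to every
graph approximation is harmonic. Only the values of `h` on the gasket matter. -/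
def IsHarmonic (k : ℕ) (h : Plane → ℝ) : Prop :=
  ContinuousOn h (gasket k) ∧ ∀ m, IsGraphHarmonic k m fun x => h x.1

/-! ### The Dirichlet problem on the first graph approximation -/

theorem F_mem_V (k : ℕ) (a : Index k) (j : Fin 3) : F k a (q j) ∈ V k 1 :=
  ⟨[a], rfl, j, rfl⟩

theorem F_apply_one (k : ℕ) (a : Index k) (x : Plane) :
    F k a x 1 = (k : ℝ)⁻¹ * (x 1 + a.1 0 * (Real.sqrt 3 / 2)) := by
  simp [F, Fin.sum_univ_three, q]
  ring

theorem F_lt (k : ℕ) (a : Index k) (j : Fin 3) (hj : j ≠ 0) :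
    F k a (q j) 1 < F k a (q 0) 1 := by
  have hk : (0 : ℝ) < k := by
    have := a.2
    exact_mod_cast (by omega : 0 < k)
  rw [F_apply_one, F_apply_one]
  have h3 : (0 : ℝ) < Real.sqrt 3 := by positivity
  apply mul_lt_mul_of_pos_left _ (inv_pos.2 hk)
  fin_cases j <;> simp_all [q]

/-- Every point of `V₁` other than the top vertex lies in a cell in which it is not the top. -/
theorem eq_or_exists_cell (k : ℕ) (x : Plane) (hx : x ∈ V k 1) :
    x = q 0 ∨ ∃ (a : Index k) (j : Fin 3), j ≠ 0 ∧ F k a (q j) = x := by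
  obtain ⟨w, hw, j, rfl⟩ := hx
  obtain ⟨a, rfl⟩ := List.length_eq_one_iff.1 hw
  change F k a (q j) = q 0 ∨ ∃ (b : Index k) (i : Fin 3), i ≠ 0 ∧ F k b (q i) = F k a (q j)
  by_cases hj : j = 0
  · subst hj
    obtain ⟨a, ha⟩ := a
    by_cases h1 : a 1 = 0
    · by_cases h2 : a 2 = 0
      · left
        have hk : (k : ℝ) = a 0 + 1 := by
          rw [← ha, h1, h2]; push_cast; ring
        have hk0 : (a 0 : ℝ) + 1 ≠ 0 := by positivity
        simp only [F, Fin.sum_univ_three, h1, h2, hk]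
        rw [← smul_add]
        simp only [Nat.cast_zero, zero_smul, add_zero]
        rw [show q 0 + (a 0 : ℝ) • q 0 = ((a 0 : ℝ) + 1) • q 0 by module, smul_smul,
          inv_mul_cancel₀ hk0, one_smul]
      · right
        obtain ⟨n, hn⟩ := Nat.exists_eq_succ_of_ne_zero h2
        refine ⟨⟨![a 0 + 1, a 1, n], by simp; omega⟩, 2, by decide, ?_⟩
        simp [F, Fin.sum_univ_three, hn]
        module
    · right
      obtain ⟨n, hn⟩ := Nat.exists_eq_succ_of_ne_zero h1
      refine ⟨⟨![a 0 + 1, n, a 2], by simp; omega⟩, 1, by decide, ?_⟩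
      simp [F, Fin.sum_univ_three, hn]
      module
  · exact Or.inr ⟨a, j, hj, rfl⟩

theorem le_zero_of_isGraphHarmonic (k : ℕ) (h : V k 1 → ℝ) (hh : IsGraphHarmonic k 1 h)
    (h0 : ∀ x : V k 1, x.1 ∈ boundary → h x = 0) (z : V k 1) : h z ≤ 0 := by
  classical
  obtain ⟨m, -, hm⟩ := Finset.exists_max_image Finset.univ h ⟨z, Finset.mem_univ z⟩
  obtain ⟨x, hxS, hx⟩ := Finset.exists_max_image (Finset.univ.filter fun y => h y = h m)
    (fun y => y.1 1) ⟨m, by simp⟩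
  replace hxS : h x = h m := by simpa using hxS
  have hzx : h z ≤ h x := hxS ▸ hm z (Finset.mem_univ z)
  refine hzx.trans ?_
  by_cases hb : x.1 ∈ boundary
  · exact (h0 x hb).le
  exfalso
  rcases eq_or_exists_cell k x.1 x.2 with hq | ⟨a, j, hj, hq⟩
  · exact hb ⟨0, hq.symm⟩
  have hlt : x.1 1 < F k a (q 0) 1 := hq ▸ F_lt k a j hj
  let y : V k 1 := ⟨F k a (q 0), F_mem_V k a 0⟩
  have hne : x ≠ y := by
    intro hxy
    have : x.1 = F k a (q 0) := congrArg Subtype.val hxy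
    rw [← this] at hlt
    exact lt_irrefl _ hlt
  have hadj : (G k 1).Adj x y := ⟨hne, [a], rfl, ⟨j, hq⟩, ⟨0, rfl⟩⟩
  have hlap := hh x hb
  unfold laplacian at hlap
  have hnp : ∀ u ∈ (G k 1).neighborFinset x, h u - h x ≤ 0 := fun u _ => by
    have := hm u (Finset.mem_univ u)
    linarith
  have hy := (Finset.sum_eq_zero_iff_of_nonpos hnp).1 (by convert hlap) y (by simpa using hadj)
  have := hx y (by simp; linarith)
  exact absurd hlt (not_lt.2 this)

theorem laplacian_add (k m : ℕ) (g h : V k m → ℝ) (x : V k m) :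
    laplacian k m (g + h) x = laplacian k m g x + laplacian k m h x := by
  simp only [laplacian, ← Finset.sum_add_distrib, Pi.add_apply]
  exact Finset.sum_congr rfl fun _ _ => by ring

theorem laplacian_smul (k m : ℕ) (c : ℝ) (h : V k m → ℝ) (x : V k m) :
    laplacian k m (c • h) x = c * laplacian k m h x := by
  simp only [laplacian, Finset.mul_sum, Pi.smul_apply, smul_eq_mul]
  exact Finset.sum_congr rfl fun _ _ => by ring

theorem eq_zero_of_isGraphHarmonic (k : ℕ) (h : V k 1 → ℝ) (hh : IsGraphHarmonic k 1 h)
    (h0 : ∀ x : V k 1, x.1 ∈ boundary → h x = 0) : h = 0 := by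
  funext z
  refine le_antisymm (le_zero_of_isGraphHarmonic k h hh h0 z) ?_
  have := le_zero_of_isGraphHarmonic k ((-1 : ℝ) • h)
    (fun x hx => by rw [laplacian_smul, hh x hx, mul_zero])
    (fun x hx => by simp [h0 x hx]) z
  simpa using this

/-- The Dirichlet problem on `G₁` has exactly one solution for all boundary values `b`. -/
theorem existsUnique_dirichlet (k : ℕ) (b : Fin 3 → ℝ) :
    ∃! h : V k 1 → ℝ, IsGraphHarmonic k 1 h ∧ ∀ (x : V k 1) (j : Fin 3), x.1 = q j → h x = b j := by
  classical
  have hinj : Function.Injective q := by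
    intro i j hij
    have e0 := congrArg (fun v : Plane => v 0) hij
    fin_cases i <;> fin_cases j <;> simp [q] at e0 ⊢
  let T : (V k 1 → ℝ) →ₗ[ℝ] (V k 1 → ℝ) :=
    { toFun := fun h x => if x.1 ∈ boundary then h x else laplacian k 1 h x
      map_add' := fun g h => by
        funext x
        by_cases hx : x.1 ∈ boundary <;> simp [hx, laplacian_add]
      map_smul' := fun c h => by
        funext x
        by_cases hx : x.1 ∈ boundary <;> simp [hx, laplacian_smul] }
  have hT : ∀ h x, T h x = if x.1 ∈ boundary then h x else laplacian k 1 h x := fun _ _ => rfl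
  have hker : Function.Injective T := by
    rw [injective_iff_map_eq_zero]
    intro h hh
    refine eq_zero_of_isGraphHarmonic k h (fun x hx => ?_) (fun x hx => ?_)
    · have := congrFun hh x
      rwa [hT, if_neg hx] at this
    · have := congrFun hh x
      rwa [hT, if_pos hx] at this
  obtain ⟨h, hh⟩ := (LinearMap.injective_iff_surjective.1 hker)
    (fun x => ∑ j, if x.1 = q j then b j else 0)
  refine ⟨h, ⟨fun x hx => ?_, fun x j hj => ?_⟩, fun g hg => hker ?_⟩
  · have := congrFun hh x
    rw [hT, if_neg hx] at this
    rw [this]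
    exact Finset.sum_eq_zero fun j _ => if_neg fun e => hx ⟨j, e.symm⟩
  · have := congrFun hh x
    rw [hT, if_pos ⟨j, hj.symm⟩] at this
    rw [this]
    simp [hj, hinj.eq_iff]
  · rw [hh]
    funext x
    rw [hT]
    by_cases hx : x.1 ∈ boundary
    · obtain ⟨j, hj⟩ := hx
      rw [if_pos ⟨j, hj⟩, hg.2 x j hj.symm]
      simp [← hj, hinj.eq_iff]
    · rw [if_neg hx, hg.1 x hx]
      exact (Finset.sum_eq_zero fun j _ => if_neg fun e => hx ⟨j, e.symm⟩).symm

/-- The harmonic function on `G₁` with boundary values `b`. -/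
noncomputable def dirichletSolution (k : ℕ) (b : Fin 3 → ℝ) : V k 1 → ℝ :=
  (existsUnique_dirichlet k b).choose

/-- The harmonic extension matrix `A_a`: its `j`-th column lists the values at
`F_a q_0, F_a q_1, F_a q_2` of the harmonic function on `G₁` with boundary values
`h (q_i) = δ_{ij}`. -/
noncomputable def harmonicExtensionMatrix (k : ℕ) (a : Index k) : Matrix (Fin 3) (Fin 3) ℝ :=
  Matrix.of fun i j => dirichletSolution k (Pi.single j 1) ⟨F k a (q i), F_mem_V k a i⟩

/-- The harmonic structure on the level-`k` gasket is non-degenerate: every harmonic extension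
matrix is invertible. -/
def IsNondegenerate (k : ℕ) : Prop :=
  ∀ a : Index k, IsUnit (harmonicExtensionMatrix k a)

/-- The defining relation of the harmonic extension matrices: they map the boundary values of a
harmonic function on `G₁` to its values at the vertices of a cell. -/
theorem harmonicExtensionMatrix_mulVec (k : ℕ) (a : Index k) (h : V k 1 → ℝ)
    (hh : IsGraphHarmonic k 1 h) (b : Fin 3 → ℝ)
    (hb : ∀ (x : V k 1) (j : Fin 3), x.1 = q j → h x = b j) :
    (harmonicExtensionMatrix k a).mulVec b =
      fun i => h ⟨F k a (q i), F_mem_V k a i⟩ := by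
  have hs : ∀ j, _ := fun j => (existsUnique_dirichlet k (Pi.single j 1)).choose_spec.1
  have key : h = ∑ j, b j • dirichletSolution k (Pi.single j 1) := by
    refine (existsUnique_dirichlet k b).unique ⟨hh, hb⟩ ⟨fun x hx => ?_, fun x i hi => ?_⟩
    · have := fun j => (hs j).1 x hx
      simp only [Fin.sum_univ_three, laplacian_add, laplacian_smul]
      simp only [dirichletSolution, this, mul_zero, add_zero]
    · have := fun j => (hs j).2 x i hi
      simp only [Finset.sum_apply, Pi.smul_apply, dirichletSolution, this, smul_eq_mul]
      simp [Pi.single_apply]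
  funext i
  rw [key]
  simp [Matrix.mulVec, dotProduct, harmonicExtensionMatrix, mul_comm]

/-! ### The gasket is the attractor of the contractions -/

theorem V_succ (k m : ℕ) : V k (m + 1) = ⋃ a : Index k, F k a '' V k m := by
  ext x
  simp only [V, Set.mem_ofPred_eq, Set.mem_iUnion, Set.mem_image]
  constructor
  · rintro ⟨w, hw, j, rfl⟩
    obtain ⟨a, v, rfl⟩ := List.exists_cons_of_length_eq_add_one hw
    exact ⟨a, _, ⟨v, by simpa using hw, j, rfl⟩, rfl⟩
  · rintro ⟨a, _, ⟨v, hv, j, rfl⟩, rfl⟩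
    exact ⟨a :: v, by simp [hv], j, rfl⟩

theorem dist_F (k : ℕ) (a : Index k) (x y : Plane) :
    dist (F k a x) (F k a y) = (k : ℝ)⁻¹ * dist x y := by
  simp only [F, dist_add_right, dist_smul₀]
  simp

theorem norm_q_le (j : Fin 3) : ‖q j‖ ≤ 1 := by
  rw [EuclideanSpace.norm_eq]
  refine Real.sqrt_le_iff.2 ⟨zero_le_one, ?_⟩
  fin_cases j <;> simp [q, Fin.sum_univ_two, div_pow]
  norm_num

theorem norm_F_le (k : ℕ) (a : Index k) (x : Plane) (hx : ‖x‖ ≤ 1) : ‖F k a x‖ ≤ 1 := by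
  have hk : (a.1 0 : ℝ) + a.1 1 + a.1 2 + 1 = k := by exact_mod_cast a.2
  have hk0 : (0 : ℝ) < k := by rw [← hk]; positivity
  have hj : ∀ j, ‖(a.1 j : ℝ) • q j‖ ≤ a.1 j := fun j => by
    rw [norm_smul, Real.norm_natCast]
    exact mul_le_of_le_one_right (by positivity) (norm_q_le j)
  rw [F, ← smul_add, norm_smul, norm_inv, Real.norm_natCast, inv_mul_le_iff₀ hk0, mul_one, ← hk,
    Fin.sum_univ_three]
  have h1 := norm_add_le x
    ((a.1 0 : ℝ) • q 0 + (a.1 1 : ℝ) • q 1 + (a.1 2 : ℝ) • q 2)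
  have h2 := norm_add₃_le (a := (a.1 0 : ℝ) • q 0) (b := (a.1 1 : ℝ) • q 1)
    (c := (a.1 2 : ℝ) • q 2)
  linarith [hj 0, hj 1, hj 2]

theorem V_subset_ball (k m : ℕ) : V k m ⊆ Metric.closedBall 0 1 := by
  induction m with
  | zero =>
    rintro x ⟨w, hw, j, rfl⟩
    rw [List.length_eq_zero_iff.1 hw]
    simpa [wordMap] using norm_q_le j
  | succ m ih =>
    rw [V_succ]
    refine Set.iUnion_subset fun a => ?_
    rintro _ ⟨x, hx, rfl⟩
    simpa using norm_F_le k a x (by simpa using ih hx)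

theorem V_zero (k : ℕ) : V k 0 = boundary := by
  ext x
  constructor
  · rintro ⟨w, hw, j, rfl⟩
    rw [List.length_eq_zero_iff.1 hw]
    exact ⟨j, rfl⟩
  · rintro ⟨j, rfl⟩
    exact ⟨[], rfl, j, rfl⟩

theorem boundary_subset_V_one (k : ℕ) (hk : 1 ≤ k) : boundary ⊆ V k 1 := by
  rintro _ ⟨j, rfl⟩
  let a : Index k := ⟨Pi.single j (k - 1), by fin_cases j <;> simp <;> omega⟩
  have hk0 : (k : ℝ) ≠ 0 := by positivity
  have ha : F k a (q j) = q j := by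
    have : ∑ i, (a.1 i : ℝ) • q i = ((k : ℝ) - 1) • q j := by
      rw [Finset.sum_eq_single j]
      · simp [a, Nat.cast_sub hk]
      · intro i _ hi
        simp [a, hi]
      · simp
    rw [F, this, ← smul_add, show q j + ((k : ℝ) - 1) • q j = (k : ℝ) • q j by module, smul_smul,
      inv_mul_cancel₀ hk0, one_smul]
  exact ⟨[a], rfl, j, ha⟩

/-- The gasket is a non-empty compact set with `K = ⋃ a, F_a K`. -/
theorem isAttractor_gasket (k : ℕ) (hk : 2 ≤ k) : IsAttractor k (gasket k) := by
  have hcpt : IsCompact (gasket k) := by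
    refine (isCompact_closedBall (0 : Plane) 1).of_isClosed_subset isClosed_closure ?_
    exact closure_minimal (Set.iUnion_subset (V_subset_ball k)) Metric.isClosed_closedBall
  refine ⟨⟨q 0, subset_closure (Set.mem_iUnion.2 ⟨0, [], rfl, 0, rfl⟩)⟩, hcpt, ?_⟩
  have hcont : ∀ a : Index k, Continuous (F k a) := fun a => by unfold F; fun_prop
  have hU : (⋃ m, V k m) = ⋃ a : Index k, F k a '' ⋃ m, V k m := by
    have h1 : (⋃ a : Index k, F k a '' ⋃ m, V k m) = ⋃ m, V k (m + 1) := by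
      simp only [V_succ, Set.image_iUnion]
      exact Set.iUnion_comm _
    rw [h1]
    refine Set.Subset.antisymm (Set.iUnion_subset fun m => ?_)
      (Set.iUnion_subset fun m => Set.subset_iUnion (V k) (m + 1))
    cases m with
    | zero =>
      rw [V_zero]
      exact (boundary_subset_V_one k (by omega)).trans (Set.subset_iUnion (fun m => V k (m + 1)) 0)
    | succ m => exact Set.subset_iUnion (fun m => V k (m + 1)) m
  have himg : ∀ a : Index k, F k a '' gasket k = closure (F k a '' ⋃ m, V k m) := fun a =>
    image_closure_of_isCompact hcpt (hcont a).continuousOn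
  conv_lhs => rw [gasket, hU, closure_iUnion_of_finite]
  simp only [himg]

theorem subset_of_isAttractor (k : ℕ) (hk : 2 ≤ k) (K L : Set Plane) (hK : IsAttractor k K)
    (hL : IsAttractor k L) : L ⊆ K := by
  obtain ⟨x, hx, hmax⟩ := hL.2.1.exists_isMaxOn hL.1 (Metric.continuous_infDist_pt K).continuousOn
  obtain ⟨a, y, hy, hyx⟩ : ∃ a : Index k, ∃ y ∈ L, F k a y = x := by
    have := hx
    rw [hL.2.2] at this
    simpa using this
  obtain ⟨z, hz, hyz⟩ := hK.2.1.exists_infDist_eq_dist hK.1 y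
  have hzK : F k a z ∈ K := by
    rw [hK.2.2]
    exact Set.mem_iUnion.2 ⟨a, z, hz, rfl⟩
  have h1 : Metric.infDist x K ≤ (k : ℝ)⁻¹ * Metric.infDist y K := by
    rw [hyz, ← dist_F k a, hyx]
    exact Metric.infDist_le_dist_of_mem hzK
  have h2 : Metric.infDist y K ≤ Metric.infDist x K := hmax hy
  have h0 := Metric.infDist_nonneg (x := x) (s := K)
  have hk2 : (k : ℝ)⁻¹ ≤ 1 / 2 := by
    rw [one_div]
    exact inv_anti₀ (by norm_num) (by exact_mod_cast hk)
  have h3 : Metric.infDist x K ≤ 0 := by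
    have hy0 := Metric.infDist_nonneg (x := y) (s := K)
    nlinarith
  intro u hu
  have h4 : Metric.infDist u K ≤ 0 := (hmax hu).trans h3
  exact (hK.2.1.isClosed.mem_iff_infDist_zero hK.1).2 (le_antisymm h4 Metric.infDist_nonneg)

/-- The gasket is the only attractor. -/
theorem eq_gasket_of_isAttractor (k : ℕ) (hk : 2 ≤ k) (K : Set Plane) (hK : IsAttractor k K) :
    K = gasket k :=
  (subset_of_isAttractor k hk _ _ (isAttractor_gasket k hk) hK).antisymm
    (subset_of_isAttractor k hk _ _ hK (isAttractor_gasket k hk))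

end SierpinskiGasket

/-!
The graph `G₁` is the triangular grid of side `k`, since every edge of the grid belongs to exactly
one upward triangle. Both the invertibility of the matrices `A_a` and the other two claims reduce to
one statement, `eq_of_eq_on_cell`: a function that is harmonic on the grid away from the three
corners, and constant on a small triangle, is constant.

The proof is an index count. Break ties of `h` by a linear form that does not vanish in any edge
direction, so that neighbouring vertices have different values. Then each of the `k ^ 2` small
triangles (upward and downward) has exactly one vertex with the median value, and the triangles at a
vertex `v` in which `v` is the median correspond to the sign changes of `h - h v` along the link
of `v` (`sum_signChanges_le`). Around an inner vertex there are at least two sign changes, and at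
least one around a vertex on a side: if `h` is not constant near `v`, harmonicity gives neighbours
with a larger and with a smaller value, and if it is, then the linear form takes opposite values in
opposite directions. These lower bounds add up to
`(k - 1) * (k - 2) + 3 * (k - 1) = k ^ 2 - 1`, only one less than the number of triangles.

Suppose now that `h` is constant on a triangle with a vertex `v`, not a corner, around which `h` is
not constant. Then there are two consecutive neighbours of `v` at which `h` equals `h v`, next to one
at which it does not, and the linear form can be chosen so that the signs at these three neighbours
alternate. This produces two more sign changes than the lower bound at `v` (`exists_tieBreak`), too
many for the number of triangles. Hence `h` is constant around `v`
(`locally_constant_of_triangle`), and since the grid without its corners is connected, it is constant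
everywhere.

For functions on the gasket, the maximum principle on every `G_m` and density of the vertices extend
constancy from `V₁` to the gasket.
-/

namespace SierpinskiGasket

/-! ### Sign changes along the link of a vertex -/

/-- The number of cyclically consecutive pairs in `N` along which `σ` changes its value. -/
def signChanges (N : Finset (Fin 6)) (σ : Fin 6 → Bool) : ℕ :=
  (Finset.univ.filter fun s => s ∈ N ∧ s + 1 ∈ N ∧ σ s ≠ σ (s + 1)).card

/-- `N` is the set of directions of the edges at a vertex of a triangular grid which is not a
corner: the full hexagon for an inner vertex, half of a hexagon for a vertex on a side. -/
def IsLink (N : Finset (Fin 6)) : Prop :=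
  N = Finset.univ ∨ ∃ b : Fin 6, N = {b, b + 1, b + 2, b + 3}

/-- The numbers on the left are two for an inner vertex and one for a vertex on a side. -/
theorem IsLink.le_signChanges {N : Finset (Fin 6)} (hN : IsLink N) (σ : Fin 6 → Bool)
    (hσ : ∃ s ∈ N, ∃ t ∈ N, σ s ≠ σ t) : N.card / 2 - 1 ≤ signChanges N σ := by
  rcases hN with rfl | ⟨b, rfl⟩
  · revert σ; decide +kernel
  · revert σ b; decide +kernel

/-- If the signs alternate along three consecutive members of a link, two of which are `p` and
`p + 1`, and both signs occur among the other members than `p` and `p + 1`, then there are two sign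
changes more than the minimal number. -/
theorem IsLink.add_two_le_signChanges {N : Finset (Fin 6)} (hN : IsLink N) (σ : Fin 6 → Bool)
    (p : Fin 6) (hp : p ∈ N) (hp1 : p + 1 ∈ N) (hne : σ p ≠ σ (p + 1))
    (hadj : (p - 1 ∈ N ∧ σ (p - 1) ≠ σ p) ∨ (p + 2 ∈ N ∧ σ (p + 2) ≠ σ (p + 1)))
    (hσ : ∃ s ∈ N, (s ≠ p ∧ s ≠ p + 1) ∧ ∃ t ∈ N, (t ≠ p ∧ t ≠ p + 1) ∧ σ s ≠ σ t) :
    N.card / 2 - 1 + 2 ≤ signChanges N σ := by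
  rcases hN with rfl | ⟨b, rfl⟩
  · revert σ p; decide +kernel
  · revert σ p b; decide +kernel

/-- If two consecutive members of a link belong to the set `z`, but not all members do, then some
pair of consecutive members in `z` lies next to a member outside `z`. -/
theorem IsLink.exists_boundary_pair {N : Finset (Fin 6)} (hN : IsLink N) (z : Fin 6 → Bool)
    (hz : ∃ s ∈ N, s + 1 ∈ N ∧ z s = true ∧ z (s + 1) = true) (hz' : ∃ s ∈ N, z s = false) :
    ∃ p ∈ N, p + 1 ∈ N ∧ z p = true ∧ z (p + 1) = true ∧
      ((p - 1 ∈ N ∧ z (p - 1) = false) ∨ (p + 2 ∈ N ∧ z (p + 2) = false)) := by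
  rcases hN with rfl | ⟨b, rfl⟩
  · revert z; decide +kernel
  · revert z b; decide +kernel

/-! ### The triangular grid -/

/-- The six edge directions of the triangular grid, in cyclic order. -/
def step : Fin 6 → ℤ × ℤ := ![(1, 0), (0, 1), (-1, 1), (-1, 0), (0, -1), (1, -1)]

/-- The vertices of the triangular grid of side `k`: the pair `(i, j)` stands for the point with
barycentric coordinates `((k - i - j) / k, i / k, j / k)`. -/
noncomputable def grid (k : ℕ) : Finset (ℤ × ℤ) :=
  (Finset.Icc 0 (k : ℤ) ×ˢ Finset.Icc 0 (k : ℤ)).filter fun v => v.1 + v.2 ≤ k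

theorem mem_grid {k : ℕ} {v : ℤ × ℤ} : v ∈ grid k ↔ 0 ≤ v.1 ∧ 0 ≤ v.2 ∧ v.1 + v.2 ≤ k := by
  simp only [grid, Finset.mem_filter, Finset.mem_product, Finset.mem_Icc]
  omega

/-- The three corners of the triangular grid. -/
def IsCorner (k : ℕ) (v : ℤ × ℤ) : Prop := v = (0, 0) ∨ v = ((k : ℤ), 0) ∨ v = (0, (k : ℤ))

/-- The directions in which a vertex has a neighbour in the grid. -/
noncomputable def link (k : ℕ) (v : ℤ × ℤ) : Finset (Fin 6) :=
  Finset.univ.filter fun s => v + step s ∈ grid k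

theorem mem_link {k : ℕ} {v : ℤ × ℤ} {s : Fin 6} : s ∈ link k v ↔ v + step s ∈ grid k := by
  simp [link]

theorem step_add_two (s : Fin 6) : step (s + 2) = step (s + 1) - step s := by
  revert s; decide

theorem step_add_three (s : Fin 6) : step (s + 3) = -step s := by
  revert s; decide

theorem link_cases {k : ℕ} {v : ℤ × ℤ} (hv : v ∈ grid k) (hc : ¬IsCorner k v) :
    (link k v = Finset.univ ∧ 1 ≤ v.1 ∧ 1 ≤ v.2 ∧ v.1 + v.2 < k) ∨
    (link k v = {0, 1, 2, 3} ∧ 1 ≤ v.1 ∧ v.2 = 0 ∧ v.1 + v.2 < k) ∨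
    (link k v = {2, 3, 4, 5} ∧ 1 ≤ v.1 ∧ 1 ≤ v.2 ∧ v.1 + v.2 = k) ∨
    (link k v = {4, 5, 0, 1} ∧ v.1 = 0 ∧ 1 ≤ v.2 ∧ v.1 + v.2 < k) := by
  obtain ⟨x, y⟩ := v
  simp only [mem_grid, IsCorner, Prod.mk.injEq] at hv hc
  have key : ∀ s, s ∈ link k (x, y) ↔
      0 ≤ x + (step s).1 ∧ 0 ≤ y + (step s).2 ∧ x + (step s).1 + (y + (step s).2) ≤ k :=
    fun s => by rw [mem_link, mem_grid]; rfl
  by_cases hy : y = 0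
  · refine Or.inr (Or.inl ⟨?_, by dsimp only; omega⟩)
    ext s; rw [key]; fin_cases s <;> simp [step] <;> omega
  by_cases hx : x = 0
  · refine Or.inr (Or.inr (Or.inr ⟨?_, by dsimp only; omega⟩))
    ext s; rw [key]; fin_cases s <;> simp [step] <;> omega
  by_cases hxy : x + y = k
  · refine Or.inr (Or.inr (Or.inl ⟨?_, by dsimp only; omega⟩))
    ext s; rw [key]; fin_cases s <;> simp [step] <;> omega
  · refine Or.inl ⟨?_, by dsimp only; omega⟩
    ext s; rw [key]; fin_cases s <;> simp [step] <;> omega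

theorem isLink_link {k : ℕ} {v : ℤ × ℤ} (hv : v ∈ grid k) (hc : ¬IsCorner k v) :
    IsLink (link k v) := by
  rcases link_cases hv hc with h | h | h | h
  · exact Or.inl h.1
  · exact Or.inr ⟨0, h.1⟩
  · exact Or.inr ⟨2, h.1⟩
  · exact Or.inr ⟨4, h.1⟩

/-- A count of triangles at `v`: the upward one whose last vertex is `v`, and the downward one whose
first vertex is `v`. Each triangle of the grid is counted at exactly one vertex. -/
def triangleCount (k : ℕ) (v : ℤ × ℤ) : ℕ :=
  (if 1 ≤ v.2 then 1 else 0) + if 1 ≤ v.1 ∧ v.1 + v.2 < k then 1 else 0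

/-- Away from the corners, the triangle count is the minimal number of sign changes in the link. -/
theorem triangleCount_eq {k : ℕ} {v : ℤ × ℤ} (hv : v ∈ grid k) (hc : ¬IsCorner k v) :
    triangleCount k v = (link k v).card / 2 - 1 := by
  rcases link_cases hv hc with h | h | h | h <;> rw [h.1] <;> simp +decide [triangleCount] <;>
    split_ifs <;> omega

/-- The triangle counts at the corners add up to one: this is all by which the number of triangles
exceeds the sum of the minimal numbers of sign changes. -/
theorem triangleCount_corner_le {k : ℕ} {v : ℤ × ℤ} (hc : IsCorner k v) :
    triangleCount k v ≤ if v = (0, (k : ℤ)) then 1 else 0 := by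
  rcases hc with rfl | rfl | rfl <;> simp [triangleCount]
  split_ifs <;> omega

/-- A name for the triangle spanned by `v`, `v + step s` and `v + step (s + 1)`: the last vertex of
an upward triangle (on the left), the first vertex of a downward one (on the right). -/
def triangleName (v : ℤ × ℤ) : Fin 6 → (ℤ × ℤ) ⊕ (ℤ × ℤ) :=
  ![.inl (v + (0, 1)), .inr v, .inl (v + (-1, 1)), .inr (v + (0, -1)), .inl v, .inr (v + (1, -1))]

/-- A triangle has the same name as seen from its three vertices, and from nowhere else. -/
theorem eq_or_of_triangleName_eq {v w : ℤ × ℤ} {s t : Fin 6}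
    (h : triangleName v s = triangleName w t) :
    (w = v ∧ t = s) ∨ (w = v + step s ∧ t = s + 2) ∨ (v = w + step t ∧ s = t + 2) := by
  obtain ⟨x, y⟩ := v
  obtain ⟨x', y'⟩ := w
  fin_cases s <;> fin_cases t <;> simp [triangleName, step] at h ⊢ <;> omega

/-! ### Counting medians -/

section Median

variable {α : Type*} [LinearOrder α]

open Classical in
/-- The comparison of the value at `v` with the values at its neighbours. -/
noncomputable def above (f : ℤ × ℤ → α) (v : ℤ × ℤ) (s : Fin 6) : Bool :=
  decide (f v < f (v + step s))

/-- If `f` takes different values at neighbouring vertices, then every triangle of the grid has at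
most one vertex at which the value of `f` is the median, so the sign changes in the links of all
vertices add up to at most the number of triangles. -/
theorem sum_signChanges_le (k : ℕ) (f : ℤ × ℤ → α) (hf : ∀ v s, f v ≠ f (v + step s)) :
    ∑ v ∈ grid k, signChanges (link k v) (above f v) ≤ ∑ v ∈ grid k, triangleCount k v := by
  have hR : ∑ v ∈ grid k, triangleCount k v =
      (((grid k).filter fun v : ℤ × ℤ => 1 ≤ v.2).disjSum
        ((grid k).filter fun v : ℤ × ℤ => 1 ≤ v.1 ∧ v.1 + v.2 < k)).card := by
    simp only [triangleCount, Finset.sum_add_distrib, Finset.card_disjSum, Finset.card_filter]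
  rw [hR]
  simp only [signChanges]
  rw [← Finset.card_sigma]
  refine Finset.card_le_card_of_injOn (fun x => triangleName x.1 x.2) ?_ ?_
  · rintro ⟨⟨x, y⟩, s⟩ h
    simp only [Finset.coe_sigma, Set.mem_sigma_iff, Finset.mem_coe, Finset.mem_filter,
      mem_link, mem_grid, Prod.fst_add, Prod.snd_add] at h
    obtain ⟨h0, -, h1, h2, -⟩ := h
    fin_cases s <;> simp [triangleName, step, mem_grid] at h1 h2 ⊢ <;> omega
  · have key : ∀ (v w : ℤ × ℤ) (s t : Fin 6), above f v s ≠ above f v (s + 1) →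
        above f w t ≠ above f w (t + 1) → w = v + step s → t = s + 2 → False := by
      rintro v w s t h1 h2 rfl rfl
      have e1 : v + step s + step (s + 2) = v + step (s + 1) := by rw [step_add_two]; abel
      have e2 : v + step s + step (s + 2 + 1) = v := by
        rw [show s + 2 + 1 = s + 3 by rw [add_assoc]; rfl, step_add_three]; abel
      have n1 := hf v s
      have n2 := hf v (s + 1)
      have n3 := hf (v + step s) (s + 2)
      rw [e1] at n3
      simp only [above, e1, e2, ne_eq, decide_eq_decide] at h1 h2
      rcases lt_or_gt_of_ne n1 with a | a <;> rcases lt_or_gt_of_ne n2 with b | b <;>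
        rcases lt_or_gt_of_ne n3 with c | c <;>
        simp [a, b, c, a.not_gt, b.not_gt, c.not_gt] at h1 h2
      · exact lt_irrefl _ ((a.trans c).trans b)
      · exact lt_irrefl _ ((b.trans c).trans a)
    rintro ⟨v, s⟩ h ⟨w, t⟩ h' hst
    simp only [Finset.coe_sigma, Set.mem_sigma_iff, Finset.mem_coe, Finset.mem_filter] at h h'
    rcases eq_or_of_triangleName_eq hst with ⟨rfl, rfl⟩ | ⟨h1, h2⟩ | ⟨h1, h2⟩
    · rfl
    · exact (key v w s t h.2.2.2.2 h'.2.2.2.2 h1 h2).elim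
    · exact (key w v t s h'.2.2.2.2 h.2.2.2.2 h1 h2).elim

end Median

/-! ### Ties broken by a linear form -/

/-- The linear form with coefficients `c`. -/
def linForm (c v : ℤ × ℤ) : ℤ := c.1 * v.1 + c.2 * v.2

theorem linForm_add (c v w : ℤ × ℤ) : linForm c (v + w) = linForm c v + linForm c w := by
  simp only [linForm, Prod.fst_add, Prod.snd_add]; ring

/-- The function `h`, with ties broken by a linear form. -/
def tieBreak (h : ℤ × ℤ → ℝ) (c v : ℤ × ℤ) : ℝ ×ₗ ℤ := toLex (h v, linForm c v)

section TieBreak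

variable {h : ℤ × ℤ → ℝ} {c v : ℤ × ℤ} {s : Fin 6}

theorem tieBreak_ne (hc : ∀ s, linForm c (step s) ≠ 0) (v : ℤ × ℤ) (s : Fin 6) :
    tieBreak h c v ≠ tieBreak h c (v + step s) := by
  intro he
  have := congrArg (fun x => (ofLex x).2) he
  simp only [tieBreak, ofLex_toLex, linForm_add] at this
  exact hc s (by omega)

theorem above_of_lt (hs : h v < h (v + step s)) : above (tieBreak h c) v s = true := by
  simp [above, tieBreak, Prod.Lex.toLex_lt_toLex, hs]

theorem above_of_gt (hs : h (v + step s) < h v) : above (tieBreak h c) v s = false := by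
  simp [above, tieBreak, Prod.Lex.toLex_lt_toLex, hs.not_gt, hs.ne']

theorem above_of_eq (hs : h (v + step s) = h v) :
    above (tieBreak h c) v s = decide (0 < linForm c (step s)) := by
  simp [above, tieBreak, Prod.Lex.toLex_lt_toLex, hs, linForm_add]

theorem linForm_step_add_three (c : ℤ × ℤ) (s : Fin 6) :
    linForm c (step (s + 3)) = -linForm c (step s) := by
  simp only [step_add_three, linForm, Prod.fst_neg, Prod.snd_neg]; ring

/-- A linear form without zeros among the edge directions, with prescribed opposite signs in two
consecutive directions. -/
theorem exists_linForm (p : Fin 6) (b : Bool) : ∃ c : ℤ × ℤ, (∀ s, linForm c (step s) ≠ 0) ∧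
    decide (0 < linForm c (step p)) = b ∧ decide (0 < linForm c (step (p + 1))) = !b := by
  have : ∃ c ∈ ({(1, 2), (2, 1), (1, -1), (-1, -2), (-2, -1), (-1, 1)} : Finset (ℤ × ℤ)),
      (∀ s, linForm c (step s) ≠ 0) ∧
      decide (0 < linForm c (step p)) = b ∧ decide (0 < linForm c (step (p + 1))) = !b := by
    revert p b; decide +kernel
  obtain ⟨c, -, hc⟩ := this
  exact ⟨c, hc⟩

/-- The consequence of harmonicity used below: a vertex of the grid which is not a corner, and has a
neighbour with a different value, has both a neighbour with a larger and one with a smaller value. -/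
def HasNoStrictExtremum (k : ℕ) (h : ℤ × ℤ → ℝ) : Prop :=
  ∀ v ∈ grid k, ¬IsCorner k v → (∃ s ∈ link k v, h (v + step s) ≠ h v) →
    (∃ s ∈ link k v, h v < h (v + step s)) ∧ ∃ s ∈ link k v, h (v + step s) < h v

/-- After breaking ties, every vertex other than the corners has neighbours of both signs, even if
`h` is constant around it. -/
theorem exists_above_ne {k : ℕ} (hh : HasNoStrictExtremum k h) (hc : ∀ s, linForm c (step s) ≠ 0)
    (hv : v ∈ grid k) (hcv : ¬IsCorner k v) :
    ∃ s ∈ link k v, ∃ t ∈ link k v, above (tieBreak h c) v s ≠ above (tieBreak h c) v t := by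
  by_cases hfl : ∃ s ∈ link k v, h (v + step s) ≠ h v
  · obtain ⟨⟨s, hs, hs'⟩, t, ht, ht'⟩ := hh v hv hcv hfl
    exact ⟨s, hs, t, ht, by rw [above_of_lt hs', above_of_gt ht']; decide⟩
  -- At a locally constant vertex the linear form decides, and it takes opposite values in opposite
  -- directions.
  push Not at hfl
  obtain ⟨s, hs, hs3⟩ : ∃ s ∈ link k v, s + 3 ∈ link k v := by
    rcases isLink_link hv hcv with hN | ⟨b, hN⟩
    · exact ⟨0, by simp [hN], by simp [hN]⟩
    · exact ⟨b, by simp [hN], by simp [hN]⟩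
  refine ⟨s, hs, s + 3, hs3, ?_⟩
  rw [above_of_eq (hfl s hs), above_of_eq (hfl _ hs3), linForm_step_add_three]
  have := hc s
  simp only [ne_eq, decide_eq_decide]
  omega

theorem triangleCount_le_signChanges {k : ℕ} (hh : HasNoStrictExtremum k h)
    (hc : ∀ s, linForm c (step s) ≠ 0) (hv : v ∈ grid k) :
    triangleCount k v ≤
      signChanges (link k v) (above (tieBreak h c) v) + if v = (0, (k : ℤ)) then 1 else 0 := by
  by_cases hcv : IsCorner k v
  · exact (triangleCount_corner_le hcv).trans (Nat.le_add_left _ _)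
  · rw [triangleCount_eq hv hcv]
    exact ((isLink_link hv hcv).le_signChanges _ (exists_above_ne hh hc hv hcv)).trans
      (Nat.le_add_right _ _)

/-- If `h` is constant on a triangle at `v` but not around `v`, ties can be broken in such a way
that the link of `v` has two sign changes more than are needed. -/
theorem exists_tieBreak {k : ℕ} (hh : HasNoStrictExtremum k h) (hv : v ∈ grid k)
    (hcv : ¬IsCorner k v) (hs : ∃ s ∈ link k v, s + 1 ∈ link k v ∧ h (v + step s) = h v ∧
      h (v + step (s + 1)) = h v) (hne : ∃ s ∈ link k v, h (v + step s) ≠ h v) :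
    ∃ c, (∀ s, linForm c (step s) ≠ 0) ∧
      triangleCount k v + 2 ≤ signChanges (link k v) (above (tieBreak h c) v) := by
  classical
  have hN := isLink_link hv hcv
  rw [triangleCount_eq hv hcv]
  obtain ⟨p, hp, hp1, hzp, hzp1, hadj⟩ := hN.exists_boundary_pair
    (fun s => decide (h (v + step s) = h v)) (by simpa using hs) (by simpa using hne)
  simp only [decide_eq_true_eq, decide_eq_false_iff_not] at hzp hzp1 hadj
  obtain ⟨⟨s, hs, hs'⟩, t, ht, ht'⟩ := hh v hv hcv hne
  have hopp : ∀ c, ∃ s ∈ link k v, (s ≠ p ∧ s ≠ p + 1) ∧ ∃ t ∈ link k v, (t ≠ p ∧ t ≠ p + 1) ∧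
      above (tieBreak h c) v s ≠ above (tieBreak h c) v t := fun c => by
    refine ⟨s, hs, ⟨?_, ?_⟩, t, ht, ⟨?_, ?_⟩, by rw [above_of_lt hs', above_of_gt ht']; decide⟩
    all_goals rintro rfl
    exacts [hs'.ne' hzp, hs'.ne' hzp1, ht'.ne hzp, ht'.ne hzp1]
  have hindep : ∀ u, h (v + step u) ≠ h v → ∃ b, ∀ c, above (tieBreak h c) v u = b := by
    intro u hu
    rcases lt_or_gt_of_ne hu with hu | hu
    · exact ⟨false, fun c => above_of_gt hu⟩
    · exact ⟨true, fun c => above_of_lt hu⟩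
  rcases hadj with ⟨hm, hm'⟩ | ⟨hm, hm'⟩
  · obtain ⟨b, hb⟩ := hindep _ hm'
    obtain ⟨c, hc, h1, h2⟩ := exists_linForm p (!b)
    refine ⟨c, hc, hN.add_two_le_signChanges _ p hp hp1 ?_ (Or.inl ⟨hm, ?_⟩) (hopp c)⟩
    · rw [above_of_eq hzp, above_of_eq hzp1, h1, h2]; simp
    · rw [hb, above_of_eq hzp, h1]; simp
  · obtain ⟨b, hb⟩ := hindep _ hm'
    obtain ⟨c, hc, h1, h2⟩ := exists_linForm p b
    refine ⟨c, hc, hN.add_two_le_signChanges _ p hp hp1 ?_ (Or.inr ⟨hm, ?_⟩) (hopp c)⟩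
    · rw [above_of_eq hzp, above_of_eq hzp1, h1, h2]; simp
    · rw [hb, above_of_eq hzp1, h2]; simp

/-- A function that is constant on a triangle at `v` is constant around `v`: otherwise the sign
changes would outnumber the triangles, as two extra ones at `v` cannot be compensated by the single
one that may be missing at the corners. -/
theorem locally_constant_of_triangle {k : ℕ} (hh : HasNoStrictExtremum k h) (hv : v ∈ grid k)
    (hcv : ¬IsCorner k v) (hs : ∃ s ∈ link k v, s + 1 ∈ link k v ∧ h (v + step s) = h v ∧
      h (v + step (s + 1)) = h v) : ∀ s ∈ link k v, h (v + step s) = h v := by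
  by_contra! hne
  obtain ⟨c, hc, hlt⟩ := exists_tieBreak hh hv hcv hs hne
  have h1 : ∑ w ∈ grid k, (triangleCount k w + if w = v then 2 else 0) ≤
      ∑ w ∈ grid k, (signChanges (link k w) (above (tieBreak h c) w) +
        if w = (0, (k : ℤ)) then 1 else 0) := by
    refine Finset.sum_le_sum fun w hw => ?_
    split_ifs with hwv
    · subst hwv; omega
    · subst hwv; omega
    all_goals simpa [*] using triangleCount_le_signChanges hh hc hw
  have h2 := sum_signChanges_le k (tieBreak h c) (tieBreak_ne hc)
  have h0 : ((0 : ℤ), (k : ℤ)) ∈ grid k := by simp [mem_grid]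
  rw [Finset.sum_add_distrib, Finset.sum_add_distrib, Finset.sum_ite_eq' _ v,
    Finset.sum_ite_eq' _ (0, (k : ℤ)), if_pos hv, if_pos h0] at h1
  omega

end TieBreak

/-! ### Functions that are constant on a triangle of the grid -/

section Propagation

variable {k : ℕ} {h : ℤ × ℤ → ℝ} {v : ℤ × ℤ} {s : Fin 6}

/-- `h` takes the value `r` at the vertices of some triangle of the grid at `v`. -/
def ConstTriangleAt (k : ℕ) (h : ℤ × ℤ → ℝ) (r : ℝ) (v : ℤ × ℤ) : Prop :=
  h v = r ∧ ∃ s ∈ link k v, s + 1 ∈ link k v ∧ h (v + step s) = r ∧ h (v + step (s + 1)) = r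

theorem ConstTriangleAt.eq {r : ℝ} (hT : ConstTriangleAt k h r v)
    (hh : HasNoStrictExtremum k h) (hv : v ∈ grid k) (hcv : ¬IsCorner k v) (hs : s ∈ link k v) :
    h (v + step s) = r := by
  obtain ⟨rfl, hT⟩ := hT
  exact locally_constant_of_triangle hh hv hcv hT s hs

/-- Every edge at `v` lies in a triangle at `v`, so a neighbour of `v` inherits a constant
triangle. -/
theorem ConstTriangleAt.neighbor {r : ℝ} (hT : ConstTriangleAt k h r v)
    (hh : HasNoStrictExtremum k h) (hv : v ∈ grid k) (hcv : ¬IsCorner k v) (hs : s ∈ link k v) :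
    ConstTriangleAt k h r (v + step s) := by
  have hnb : s + 1 ∈ link k v ∨ s - 1 ∈ link k v := by
    rcases isLink_link hv hcv with hN | ⟨b, hN⟩
    · simp [hN]
    · rw [hN] at hs ⊢
      clear hT hN
      revert s b; decide +kernel
  have e3 : v + step s + step (s + 3) = v := by
    rw [step_add_three]; abel
  refine ⟨hT.eq hh hv hcv hs, ?_⟩
  rcases hnb with hn | hn
  · have e2 : v + step s + step (s + 2) =
        v + step (s + 1) := by
      rw [step_add_two]; abel
    have e3' : s + 2 + 1 = s + 3 := by rw [add_assoc]; rfl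
    refine ⟨s + 2, ?_, ?_, ?_, ?_⟩
    · rw [mem_link, e2]; exact mem_link.1 hn
    · rw [e3', mem_link, e3]; exact hv
    · rw [e2]; exact hT.eq hh hv hcv hn
    · rw [e3', e3]; exact hT.1
  · have e4 : v + step s + step (s + 3 + 1) =
        v + step (s - 1) := by
      rw [add_assoc]
      congr 1
      clear hT hs e3 hn
      revert s; decide
    refine ⟨s + 3, ?_, ?_, ?_, ?_⟩
    · rw [mem_link, e3]; exact hv
    · rw [mem_link, e4]; exact mem_link.1 hn
    · rw [e3]; exact hT.1
    · rw [e4]; exact hT.eq hh hv hcv hn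

theorem constTriangleAt_iff_step {r : ℝ} (hh : HasNoStrictExtremum k h) (hv : v ∈ grid k)
    (hcv : ¬IsCorner k v) (hw : v + step s ∈ grid k) (hcw : ¬IsCorner k (v + step s)) :
    ConstTriangleAt k h r v ↔ ConstTriangleAt k h r (v + step s) := by
  refine ⟨fun hT => hT.neighbor hh hv hcv (mem_link.2 hw), fun hT => ?_⟩
  have e3 : v + step s + step (s + 3) = v := by rw [step_add_three]; abel
  have := hT.neighbor (s := s + 3) hh hw hcw (by rw [mem_link, e3]; exact hv)
  rwa [e3] at this

/-- The grid without its corners is connected: every vertex of it is joined to `(0, 1)`. -/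
theorem constTriangleAt_iff {r : ℝ} (hh : HasNoStrictExtremum k h) (hk : 2 ≤ k) :
    ∀ (n : ℕ) (v : ℤ × ℤ), 2 * v.1 + v.2 ≤ n → v ∈ grid k → ¬IsCorner k v →
      (ConstTriangleAt k h r v ↔ ConstTriangleAt k h r (0, 1)) := by
  intro n
  induction n with
  | zero =>
    rintro ⟨x, y⟩ hn hv hcv
    simp only [mem_grid, IsCorner, Prod.mk.injEq, Nat.cast_zero] at hn hv hcv
    omega
  | succ n ih =>
    rintro ⟨x, y⟩ hn hv hcv
    have hv' := mem_grid.1 hv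
    have hcv' := hcv
    simp only [IsCorner, Prod.mk.injEq] at hcv'
    push_cast at hn
    dsimp only at hn hv'
    -- Moves that decrease `2 * i + j`, keep inside the grid and avoid the corners.
    have move : ∀ s : Fin 6, (x, y) + step s ∈ grid k → ¬IsCorner k ((x, y) + step s) →
        2 * ((x, y) + step s).1 + ((x, y) + step s).2 ≤ n →
        (ConstTriangleAt k h r (x, y) ↔ ConstTriangleAt k h r (0, 1)) := fun s h1 h2 h3 =>
      (constTriangleAt_iff_step hh hv hcv h1 h2).trans (ih _ h3 h1 h2)
    by_cases hB : x = 0 ∧ y = 1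
    · rw [hB.1, hB.2]
    by_cases hx : x = 0
    · refine move 4 ?_ ?_ ?_ <;> simp [step, mem_grid, IsCorner] <;> omega
    by_cases hxy : x = 1 ∧ y = 0
    · refine move 2 ?_ ?_ ?_ <;> simp [step, mem_grid, IsCorner] <;> omega
    · refine move 3 ?_ ?_ ?_ <;> simp [step, mem_grid, IsCorner] <;> omega

theorem eq_of_constTriangleAt {r : ℝ} (hh : HasNoStrictExtremum k h) (hk : 2 ≤ k)
    (hv : v ∈ grid k) (hcv : ¬IsCorner k v) (hT : ConstTriangleAt k h r v) :
    ∀ w ∈ grid k, h w = r := by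
  have hall : ∀ w ∈ grid k, ¬IsCorner k w → ConstTriangleAt k h r w := by
    have aux : ∀ w ∈ grid k, ¬IsCorner k w →
        (ConstTriangleAt k h r w ↔ ConstTriangleAt k h r (0, 1)) := fun w hw hcw => by
      refine constTriangleAt_iff hh hk (2 * w.1 + w.2).toNat w ?_ hw hcw
      have := mem_grid.1 hw
      omega
    exact fun w hw hcw => (aux w hw hcw).2 ((aux v hv hcv).1 hT)
  have hnear : ∀ (u : ℤ × ℤ) (s : Fin 6), u ∈ grid k → ¬IsCorner k u → u + step s ∈ grid k →
      h (u + step s) = r := fun u s hu hcu hs =>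
    (hall u hu hcu).eq hh hu hcu (mem_link.2 hs)
  intro w hw
  by_cases hcw : IsCorner k w
  · rcases hcw with rfl | rfl | rfl
    · convert hnear (0, 1) 4 ?_ ?_ ?_ using 2 <;> simp [step, mem_grid, IsCorner] <;> omega
    · convert hnear ((k : ℤ) - 1, 0) 0 ?_ ?_ ?_ using 2 <;>
        simp [step, mem_grid, IsCorner] <;> omega
    · convert hnear (0, (k : ℤ) - 1) 1 ?_ ?_ ?_ using 2 <;>
        simp [step, mem_grid, IsCorner] <;> omega
  · exact (hall w hw hcw).1

theorem eq_of_upward_triangle {r : ℝ} (hh : HasNoStrictExtremum k h) (hk : 2 ≤ k)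
    (h0 : 0 ≤ v.1) (h0' : 0 ≤ v.2) (hlt : v.1 + v.2 < k)
    (h1 : h v = r) (h2 : h (v + (1, 0)) = r) (h3 : h (v + (0, 1)) = r) :
    ∀ w ∈ grid k, h w = r := by
  obtain ⟨x, y⟩ := v
  dsimp only at h0 h0' hlt
  by_cases hcv : IsCorner k (x, y)
  · have hxy : x = 0 ∧ y = 0 := by
      simp only [IsCorner, Prod.mk.injEq] at hcv
      omega
    obtain ⟨rfl, rfl⟩ := hxy
    -- In the triangle at the corner `(0, 0)`, the vertex `(1, 0)` is not a corner since `2 ≤ k`.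
    refine eq_of_constTriangleAt (v := (1, 0)) hh hk ?_ ?_ ⟨by simpa using h2, 2, ?_, ?_, ?_, ?_⟩
    · simp [mem_grid]; omega
    · simp [IsCorner]; omega
    · simp [mem_link, mem_grid, step]; omega
    · simp [mem_link, mem_grid, step]
    · simpa [step] using h3
    · simpa [step] using h1
  · refine eq_of_constTriangleAt (v := (x, y)) hh hk ?_ hcv ⟨h1, 0, ?_, ?_, h2, h3⟩
    · simp [mem_grid]; omega
    · simp [mem_link, mem_grid, step]; omega
    · simp [mem_link, mem_grid, step]; omega

end Propagation

/-! ### The graph `G₁` is the triangular grid -/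

/-- The point of the plane with barycentric coordinates `((k - i - j) / k, i / k, j / k)`. -/
noncomputable def gridPoint (k : ℕ) (v : ℤ × ℤ) : Plane :=
  (k : ℝ)⁻¹ • (((k : ℝ) - v.1 - v.2) • q 0 + (v.1 : ℝ) • q 1 + (v.2 : ℝ) • q 2)

/-- The position of the `j`-th vertex of an upward triangle relative to its `0`-th vertex. -/
def offset : Fin 3 → ℤ × ℤ := ![(0, 0), (1, 0), (0, 1)]

/-- The position of the `0`-th vertex of the upward triangle with index `a`. -/
def Index.base {k : ℕ} (a : Index k) : ℤ × ℤ := (a.1 1, a.1 2)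

theorem Index.base_spec {k : ℕ} (a : Index k) :
    0 ≤ a.base.1 ∧ 0 ≤ a.base.2 ∧ a.base.1 + a.base.2 < k := by
  have := a.2
  simp only [Index.base]
  omega

theorem exists_base_eq {k : ℕ} {v : ℤ × ℤ} (h0 : 0 ≤ v.1) (h0' : 0 ≤ v.2) (hlt : v.1 + v.2 < k) :
    ∃ a : Index k, a.base = v := by
  obtain ⟨x, y⟩ := v
  lift x to ℕ using h0
  lift y to ℕ using h0'
  dsimp only at hlt
  exact ⟨⟨![k - 1 - x - y, x, y], by simp; omega⟩, rfl⟩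

theorem F_q_eq_gridPoint {k : ℕ} (a : Index k) (j : Fin 3) :
    F k a (q j) = gridPoint k (a.base + offset j) := by
  have hk : (k : ℝ) = a.1 0 + a.1 1 + a.1 2 + 1 := by exact_mod_cast a.2.symm
  rw [F, ← smul_add, gridPoint]
  congr 1
  fin_cases j <;> simp [Fin.sum_univ_three, offset, Index.base, hk] <;> module

theorem base_add_offset_mem {k : ℕ} (a : Index k) (j : Fin 3) : a.base + offset j ∈ grid k := by
  have := a.base_spec
  rw [mem_grid]
  fin_cases j <;> simp [offset] <;> omega

theorem gridPoint_injective {k : ℕ} (hk : k ≠ 0) : Function.Injective (gridPoint k) := by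
  rintro ⟨x, y⟩ ⟨x', y'⟩ he
  have hk0 : (k : ℝ) ≠ 0 := by exact_mod_cast hk
  have e0 := congrArg (fun p : Plane => p 0) he
  have e1 := congrArg (fun p : Plane => p 1) he
  simp [gridPoint, q, hk0] at e0 e1
  rw [← mul_add, ← mul_add] at e0
  replace e0 := mul_left_cancel₀ (inv_ne_zero hk0) e0
  have hx : (x : ℝ) = x' := by linarith
  have hy : (y : ℝ) = y' := by linarith
  rw [Int.cast_injective hx, Int.cast_injective hy]

theorem exists_gridPoint_eq {k : ℕ} {x : Plane} (hx : x ∈ V k 1) :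
    ∃ v ∈ grid k, gridPoint k v = x := by
  obtain ⟨w, hw, j, rfl⟩ := hx
  obtain ⟨a, rfl⟩ := List.length_eq_one_iff.1 hw
  exact ⟨_, base_add_offset_mem a j, (F_q_eq_gridPoint a j).symm⟩

theorem exists_base_add_offset {k : ℕ} (hk : k ≠ 0) {v : ℤ × ℤ} (hv : v ∈ grid k) :
    ∃ (a : Index k) (j : Fin 3), a.base + offset j = v := by
  obtain ⟨x, y⟩ := v
  simp only [mem_grid] at hv
  by_cases hlt : x + y < k
  · obtain ⟨a, ha⟩ := exists_base_eq (v := (x, y)) hv.1 hv.2.1 hlt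
    exact ⟨a, 0, by rw [ha]; simp [offset]⟩
  by_cases hx : x = 0
  · obtain ⟨a, ha⟩ := exists_base_eq (k := k) (v := (x, y - 1)) (by simp; omega) (by simp; omega)
      (by simp; omega)
    exact ⟨a, 2, by rw [ha]; simp [offset]⟩
  · obtain ⟨a, ha⟩ := exists_base_eq (k := k) (v := (x - 1, y)) (by simp; omega) (by simp; omega)
      (by simp; omega)
    exact ⟨a, 1, by rw [ha]; simp [offset]⟩

theorem gridPoint_mem {k : ℕ} (hk : k ≠ 0) {v : ℤ × ℤ} (hv : v ∈ grid k) :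
    gridPoint k v ∈ V k 1 := by
  obtain ⟨a, j, rfl⟩ := exists_base_add_offset hk hv
  rw [← F_q_eq_gridPoint]
  exact F_mem_V k a j

theorem gridPoint_mem_boundary {k : ℕ} (hk : k ≠ 0) {v : ℤ × ℤ} (hv : gridPoint k v ∈ boundary) :
    IsCorner k v := by
  have hk0 : (k : ℝ) ≠ 0 := by exact_mod_cast hk
  have hq : ∀ j, q j = gridPoint k ((![(0, 0), ((k : ℤ), 0), (0, (k : ℤ))] : Fin 3 → ℤ × ℤ) j) := by
    intro j
    fin_cases j <;> simp [gridPoint, hk0]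
  obtain ⟨j, hj⟩ := hv
  rw [hq] at hj
  have := gridPoint_injective hk hj
  subst this
  fin_cases j <;> simp [IsCorner]

theorem exists_step_of_adj {k : ℕ} (hk : k ≠ 0) {v : ℤ × ℤ} {x y : V k 1}
    (hx : x.1 = gridPoint k v) (hxy : (G k 1).Adj x y) :
    ∃ s ∈ link k v, y.1 = gridPoint k (v + step s) := by
  obtain ⟨hne, w, hw, ⟨i, hi⟩, j, hj⟩ := hxy
  obtain ⟨a, rfl⟩ := List.length_eq_one_iff.1 hw
  change F k a (q i) = x.1 at hi
  change F k a (q j) = y.1 at hj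
  have hij : i ≠ j := by
    rintro rfl
    exact hne (Subtype.ext (hi.symm.trans hj))
  obtain ⟨s, hs⟩ : ∃ s, offset j = offset i + step s := by
    clear hi hj
    revert i j; decide
  rw [hx, F_q_eq_gridPoint] at hi
  have hv : a.base + offset j = v + step s := by
    rw [hs, ← add_assoc, gridPoint_injective hk hi]
  refine ⟨s, ?_, ?_⟩
  · rw [mem_link, ← hv]
    exact base_add_offset_mem a j
  · rw [← hj, F_q_eq_gridPoint, hv]

theorem adj_of_step {k : ℕ} (hk : k ≠ 0) {v : ℤ × ℤ} {s : Fin 6} {x y : V k 1} (hv : v ∈ grid k)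
    (hs : s ∈ link k v) (hx : x.1 = gridPoint k v) (hy : y.1 = gridPoint k (v + step s)) :
    (G k 1).Adj x y := by
  have key : ∃ (a : Index k) (i j : Fin 3), a.base + offset i = v ∧
      a.base + offset j = v + step s := by
    obtain ⟨m, n⟩ := v
    rw [mem_link, mem_grid] at hs
    rw [mem_grid] at hv
    -- The `0`-th vertex of the upward triangle that contains the edge, and the edge in it.
    have aux : ∀ (b : ℤ × ℤ) (i j : Fin 3), 0 ≤ b.1 → 0 ≤ b.2 → b.1 + b.2 < k →
        b + offset i = (m, n) → b + offset j = (m, n) + step s →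
        ∃ (a : Index k) (i j : Fin 3), a.base + offset i = (m, n) ∧
          a.base + offset j = (m, n) + step s := by
      intro b i j h1 h2 h3 h4 h5
      obtain ⟨a, rfl⟩ := exists_base_eq h1 h2 h3
      exact ⟨a, i, j, h4, h5⟩
    fin_cases s <;> simp [step] at hs hv
    · exact aux (m, n) 0 1 (by grind) (by grind) (by grind) (by simp [offset])
        (by simp [offset, step])
    · exact aux (m, n) 0 2 (by grind) (by grind) (by grind) (by simp [offset])
        (by simp [offset, step])
    · exact aux (m - 1, n) 1 2 (by grind) (by grind) (by grind) (by simp [offset])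
        (by simp [offset, step]; ring)
    · exact aux (m - 1, n) 1 0 (by grind) (by grind) (by grind) (by simp [offset])
        (by simp [offset, step]; ring)
    · exact aux (m, n - 1) 2 0 (by grind) (by grind) (by grind) (by simp [offset])
        (by simp [offset, step]; ring)
    · exact aux (m, n - 1) 2 1 (by grind) (by grind) (by grind) (by simp [offset])
        (by simp [offset, step]; ring)
  obtain ⟨a, i, j, hi, hj⟩ := key
  refine ⟨?_, [a], rfl, ⟨i, ?_⟩, j, ?_⟩
  · rintro rfl
    have := gridPoint_injective hk (hx.symm.trans hy)
    rw [left_eq_add] at this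
    clear hs hj hy
    revert s; decide
  · rw [hx, ← hi, ← F_q_eq_gridPoint]; rfl
  · rw [hy, ← hj, ← F_q_eq_gridPoint]; rfl

open Classical in
/-- A function on `V₁`, as a function on the grid; it is zero outside the grid. -/
noncomputable def gridValue {k : ℕ} (h : V k 1 → ℝ) (v : ℤ × ℤ) : ℝ :=
  if hv : gridPoint k v ∈ V k 1 then h ⟨gridPoint k v, hv⟩ else 0

theorem gridValue_eq {k : ℕ} (h : V k 1 → ℝ) {v : ℤ × ℤ} {x : V k 1} (hx : x.1 = gridPoint k v) :
    gridValue h v = h x := by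
  have hv : gridPoint k v ∈ V k 1 := hx ▸ x.2
  rw [gridValue, dif_pos hv]
  congr 1
  exact Subtype.ext hx.symm

theorem hasNoStrictExtremum_gridValue {k : ℕ} (hk : k ≠ 0) {h : V k 1 → ℝ}
    (hh : IsGraphHarmonic k 1 h) : HasNoStrictExtremum k (gridValue h) := by
  classical
  rintro v hv hcv ⟨s, hs, hne⟩
  let pt : ∀ u ∈ grid k, V k 1 := fun u hu => ⟨gridPoint k u, gridPoint_mem hk hu⟩
  set x := pt v hv with hx
  have hlap := hh x fun hb => hcv (gridPoint_mem_boundary hk hb)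
  unfold laplacian at hlap
  have hval : ∀ s (hs : s ∈ link k v), gridValue h (v + step s) = h (pt _ (mem_link.1 hs)) :=
    fun s hs => gridValue_eq h rfl
  have hvx : gridValue h v = h x := gridValue_eq h rfl
  have hex : ∃ y ∈ (G k 1).neighborFinset x, h y - h x ≠ 0 := by
    refine ⟨pt _ (mem_link.1 hs), ?_, ?_⟩
    · rw [SimpleGraph.mem_neighborFinset]
      exact adj_of_step hk hv hs rfl rfl
    · rw [← hval s hs, ← hvx]
      exact sub_ne_zero.2 hne
  have hback : ∀ y ∈ (G k 1).neighborFinset x, ∃ s ∈ link k v, gridValue h (v + step s) = h y := by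
    intro y hy
    rw [SimpleGraph.mem_neighborFinset] at hy
    obtain ⟨s, hs, hys⟩ := exists_step_of_adj hk rfl hy
    exact ⟨s, hs, gridValue_eq h hys⟩
  rw [hvx]
  constructor
  · obtain ⟨y, hy, hpos⟩ := Finset.exists_pos_of_sum_zero_of_exists_nonzero _ hlap hex
    obtain ⟨s, hs, hys⟩ := hback y hy
    exact ⟨s, hs, by rw [hys]; linarith⟩
  · obtain ⟨y, hy, hpos⟩ := Finset.exists_pos_of_sum_zero_of_exists_nonzero
      (s := (G k 1).neighborFinset x) (fun y => -(h y - h x))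
      (by rw [Finset.sum_neg_distrib, hlap, neg_zero])
      (by obtain ⟨y, hy, hy'⟩ := hex; exact ⟨y, hy, neg_ne_zero.2 hy'⟩)
    obtain ⟨s, hs, hys⟩ := hback y hy
    exact ⟨s, hs, by rw [hys]; linarith⟩

/-- A harmonic function on `G₁` that is constant on a cell is constant. -/
theorem eq_of_eq_on_cell {k : ℕ} (hk : 2 ≤ k) {h : V k 1 → ℝ} (hh : IsGraphHarmonic k 1 h)
    (a : Index k) {r : ℝ} (hr : ∀ i, h ⟨F k a (q i), F_mem_V k a i⟩ = r) (x : V k 1) :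
    h x = r := by
  have hk0 : k ≠ 0 := by omega
  obtain ⟨v, hv, hvx⟩ := exists_gridPoint_eq x.2
  rw [← gridValue_eq h hvx.symm]
  have hcell : ∀ j, gridValue h (a.base + offset j) = r := fun j =>
    (gridValue_eq h (F_q_eq_gridPoint a j)).trans (hr j)
  obtain ⟨h1, h2, h3⟩ := a.base_spec
  exact eq_of_upward_triangle (hasNoStrictExtremum_gridValue hk0 hh) hk h1 h2 h3
    (by simpa [offset, Prod.mk_zero_zero] using hcell 0) (hcell 1) (hcell 2) v hv

/-! ### The maximum principle on all graph approximations -/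

theorem wordMap_cons (k : ℕ) (a : Index k) (w : List (Index k)) (x : Plane) :
    wordMap k (a :: w) x = F k a (wordMap k w x) := rfl

theorem wordMap_lt {k : ℕ} (w : List (Index k)) (j : Fin 3) (hj : j ≠ 0) :
    wordMap k w (q j) 1 < wordMap k w (q 0) 1 := by
  induction w with
  | nil =>
    have h3 : (0 : ℝ) < Real.sqrt 3 := by positivity
    change q j 1 < q 0 1
    fin_cases j <;> simp_all [q]
  | cons a w ih =>
    have hk : (0 : ℝ) < k := by
      have := a.2
      exact_mod_cast (by omega : 0 < k)
    rw [wordMap_cons, wordMap_cons, F_apply_one, F_apply_one]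
    exact mul_lt_mul_of_pos_left (by linarith) (inv_pos.2 hk)

theorem exists_wordMap_fixed {k : ℕ} (hk : k ≠ 0) (m : ℕ) (j : Fin 3) :
    ∃ w : List (Index k), w.length = m ∧ wordMap k w (q j) = q j := by
  have hk0 : (k : ℝ) ≠ 0 := by exact_mod_cast hk
  obtain ⟨a, ha⟩ : ∃ a : Index k, F k a (q j) = q j := by
    let a : Index k := ⟨Pi.single j (k - 1), by fin_cases j <;> simp <;> omega⟩
    refine ⟨a, ?_⟩
    rw [F, Finset.sum_eq_single j]
    · rw [← smul_add, show a.1 j = k - 1 from Pi.single_eq_same _ _, Nat.cast_sub (by omega),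
        Nat.cast_one, show q j + ((k : ℝ) - 1) • q j = (k : ℝ) • q j by module, smul_smul, inv_mul_cancel₀ hk0,
        one_smul]
    · intro i _ hi
      simp [a, hi]
    · simp
  induction m with
  | zero => exact ⟨[], rfl, rfl⟩
  | succ m ih =>
    obtain ⟨w, hw, hwj⟩ := ih
    exact ⟨a :: w, by simp [hw], by rw [wordMap_cons, hwj, ha]⟩

/-- Every point of `V_m` other than the top vertex lies in a cell in which it is not the top. -/
theorem eq_or_exists_word {k : ℕ} (hk : k ≠ 0) (m : ℕ) (x : Plane) (hx : x ∈ V k m) :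
    x = q 0 ∨ ∃ w : List (Index k), w.length = m ∧ ∃ j ≠ 0, wordMap k w (q j) = x := by
  induction m generalizing x with
  | zero =>
    obtain ⟨w, hw, j, rfl⟩ := hx
    by_cases hj : j = 0
    · subst hj
      rw [List.length_eq_zero_iff.1 hw]
      exact Or.inl rfl
    · exact Or.inr ⟨w, hw, j, hj, rfl⟩
  | succ m ih =>
    rw [V_succ] at hx
    obtain ⟨a, y, hy, rfl⟩ := Set.mem_iUnion.1 hx
    rcases ih y hy with rfl | ⟨w, hw, j, hj, rfl⟩
    · rcases eq_or_exists_cell k _ (F_mem_V k a 0) with h0 | ⟨b, j, hj, hb⟩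
      · exact Or.inl h0
      · obtain ⟨w, hw, hwj⟩ := exists_wordMap_fixed hk m j
        exact Or.inr ⟨b :: w, by simp [hw], j, hj, by rw [wordMap_cons, hwj, hb]⟩
    · exact Or.inr ⟨a :: w, by simp [hw], j, hj, rfl⟩

/-- The maximum principle: among the points where a harmonic function on `G_m` is maximal, the
highest one lies on the boundary. -/
theorem le_of_isGraphHarmonic {k : ℕ} (hk : k ≠ 0) (m : ℕ) (h : V k m → ℝ)
    (hh : IsGraphHarmonic k m h) {r : ℝ} (h0 : ∀ x : V k m, x.1 ∈ boundary → h x ≤ r)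
    (z : V k m) : h z ≤ r := by
  classical
  obtain ⟨u, -, hu⟩ := Finset.exists_max_image Finset.univ h ⟨z, Finset.mem_univ z⟩
  obtain ⟨x, hxS, hx⟩ := Finset.exists_max_image (Finset.univ.filter fun y => h y = h u)
    (fun y => y.1 1) ⟨u, by simp⟩
  replace hxS : h x = h u := by simpa using hxS
  refine (hxS ▸ hu z (Finset.mem_univ z) : h z ≤ h x).trans ?_
  by_cases hb : x.1 ∈ boundary
  · exact h0 x hb
  exfalso
  rcases eq_or_exists_word hk m x.1 x.2 with hq | ⟨w, hw, j, hj, hq⟩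
  · exact hb ⟨0, hq.symm⟩
  have hlt : x.1 1 < wordMap k w (q 0) 1 := hq ▸ wordMap_lt w j hj
  let y : V k m := ⟨wordMap k w (q 0), w, hw, 0, rfl⟩
  have hne : x ≠ y := by
    intro hxy
    have : x.1 = wordMap k w (q 0) := congrArg Subtype.val hxy
    rw [← this] at hlt
    exact lt_irrefl _ hlt
  have hadj : (G k m).Adj x y := ⟨hne, w, hw, ⟨j, hq⟩, 0, rfl⟩
  have hlap := hh x hb
  unfold laplacian at hlap
  have hnp : ∀ v ∈ (G k m).neighborFinset x, h v - h x ≤ 0 := fun v _ => by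
    have := hu v (Finset.mem_univ v)
    linarith
  have hy := (Finset.sum_eq_zero_iff_of_nonpos hnp).1 hlap y (by simpa using hadj)
  have := hx y (by simp; linarith)
  exact absurd hlt (not_lt.2 this)

theorem eq_of_isGraphHarmonic {k : ℕ} (hk : k ≠ 0) (m : ℕ) (h : V k m → ℝ)
    (hh : IsGraphHarmonic k m h) {r : ℝ} (h0 : ∀ x : V k m, x.1 ∈ boundary → h x = r)
    (z : V k m) : h z = r := by
  refine le_antisymm (le_of_isGraphHarmonic hk m h hh (fun x hx => (h0 x hx).le) z) ?_
  have := le_of_isGraphHarmonic (r := -r) hk m ((-1 : ℝ) • h)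
    (fun x hx => by rw [laplacian_smul, hh x hx, mul_zero])
    (fun x hx => by simp [h0 x hx]) z
  simpa using this

/-- A harmonic function on the gasket that is constant on `V₁` is constant. -/
theorem IsHarmonic.eq_of_eq_on_V_one {k : ℕ} (hk : 2 ≤ k) {h : Plane → ℝ} (hh : IsHarmonic k h)
    {r : ℝ} (hr : ∀ x ∈ V k 1, h x = r) : ∀ x ∈ gasket k, h x = r := by
  have hV : Set.EqOn h (fun _ => r) (⋃ m, V k m) := by
    intro x hx
    obtain ⟨m, hm⟩ := Set.mem_iUnion.1 hx
    exact eq_of_isGraphHarmonic (by omega) m _ (hh.2 m)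
      (fun y hy => hr y.1 (boundary_subset_V_one k (by omega) hy)) ⟨x, hm⟩
  exact hV.of_subset_closure hh.1 continuousOn_const subset_closure subset_rfl

theorem isNondegenerate {k : ℕ} (hk : 2 ≤ k) : IsNondegenerate k := by
  intro a
  rw [← Matrix.mulVec_injective_iff_isUnit, ← Matrix.coe_mulVecLin, injective_iff_map_eq_zero]
  intro b hb
  obtain ⟨hh, hval⟩ := (existsUnique_dirichlet k b).choose_spec.1
  have hcell := harmonicExtensionMatrix_mulVec k a _ hh b hval
  rw [Matrix.mulVecLin_apply] at hb
  rw [hb] at hcell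
  funext j
  have hqj : q j ∈ V k 1 := boundary_subset_V_one k (by omega) ⟨j, rfl⟩
  rw [← hval ⟨q j, hqj⟩ j rfl]
  exact eq_of_eq_on_cell hk hh a (fun i => (congrFun hcell i).symm) _

end SierpinskiGasket

theorem theorem1p1 (k : ℕ) (hk : 2 ≤ k) :
    SierpinskiGasket.IsNondegenerate k ∧
      (∀ h : SierpinskiGasket.V k 1 → ℝ, SierpinskiGasket.IsGraphHarmonic k 1 h →
        ∀ a : SierpinskiGasket.Index k,
          (∃ c : ℝ, ∀ i : Fin 3,
            h ⟨SierpinskiGasket.F k a (SierpinskiGasket.q i), SierpinskiGasket.F_mem_V k a i⟩ = c) →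
          ∃ c : ℝ, ∀ x, h x = c) ∧
      ∀ h : SierpinskiGasket.Plane → ℝ, SierpinskiGasket.IsHarmonic k h →
        ∀ a : SierpinskiGasket.Index k,
          (∃ c : ℝ, ∀ x ∈ SierpinskiGasket.F k a '' SierpinskiGasket.gasket k, h x = c) →
          ∃ c : ℝ, ∀ x ∈ SierpinskiGasket.gasket k, h x = c := by
  refine ⟨SierpinskiGasket.isNondegenerate hk, fun h hh a ⟨c, hc⟩ =>
    ⟨c, SierpinskiGasket.eq_of_eq_on_cell hk hh a hc⟩, fun h hh a ⟨c, hc⟩ =>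
    ⟨c, hh.eq_of_eq_on_V_one hk fun x hx => ?_⟩⟩
  refine SierpinskiGasket.eq_of_eq_on_cell hk (hh.2 1) a (fun i => hc _ ⟨_, ?_, rfl⟩) ⟨x, hx⟩
  exact subset_closure (Set.mem_iUnion.2 ⟨0, [], rfl, i, rfl⟩)
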